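/- **Theorem 1.5.** Let $(\mathcal C,\otimes,I,C)$ be a braided monoidal category (written as if strict), and let $H$ be a Hopf algebra in $\mathcal C$ with multiplication $m$, unit $\eta$, comultiplication $\Delta$, counit $\epsilon$ and antipode $S$, such that $C_{H,H}=C_{H,H}^{-1}$. Write an object for its identity morphism. Let $H^d$ be a *faithful quasi-dual* of $H$, i.e. an algebra in $\mathcal C$ (multiplication $m$, unit $\eta$) with a morphism $\langle\,,\rangle:H^d\otimes H\to I$ such that $$\langle\,,\rangle(m\otimes H)=(\langle\,,\rangle\otimes\langle\,,\rangle)(H^d\otimes C_{H^d,H}\otimes H)(H^d\otimes H^d\otimes\Delta),\qquad \langle\,,\rangle(\eta\otimes H)=\epsilon,$$ and such that for all objects $U,V$ of $\mathcal C$: for $f,f':U\to V\otimes H^d$, $(V\otimes\langle\,,\rangle)(f\otimes H)=(V\otimes\langle\,,\rangle)(f'\otimes H)$ implies $f=f'$; and for $g,g':U\to H\otimes V$, $(\langle\,,\rangle\otimes V)(H^d\otimes g)=(\langle\,,\rangle\otimes V)(H^d\otimes g')$ implies $g=g'$. Let $H^{d'}$ be a *strict quasi-dual* of $H$, i.e.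 a left ideal of $H^d$ (a subobject $H^{d'}\hookrightarrow H^d$ such that the multiplication of $H^d$ restricts to $m:H^d\otimes H^{d'}\to H^{d'}$) together with morphisms $\rightharpoonup:H\otimes H^d\to H^d$ and $\rho:H^{d'}\to H^{d'}\otimes H$ such that $$\langle\,,\rangle(\rightharpoonup\otimes H)=\langle\,,\rangle(H^d\otimes m)(H^d\otimes C_{H,H})(C_{H,H^d}\otimes H),\qquad (H^{d'}\otimes\langle\,,\rangle)(C_{H^d,H^{d'}}\otimes H)(H^d\otimes\rho)=m,$$ and such that $\rightharpoonup$ restricts to a morphism $H\otimes H^{d'}\to H^{d'}$. Put $\leftharpoondown\;=\;\rightharpoonup(S\otimes H^{d'})\,C_{H^{d'},H}:H^{d'}\otimes H\to H^{d'}$. An *$H$-Hopf module* in $\mathcal C$ is an object $M$ that is a right $H$-module by $\alpha:M\otimes H\to M$ and a right $H$-comodule by $\phi:M\to M\otimes H$, such that $\phi\alpha=(\alpha\otimes m)(M\otimes C_{H,H}\otimes H)(\phi\otimes\Delta)$; morphisms of Hopf modules are the morphisms of $\mathcal C$ that are both $H$-linear and $H$-colinear. Let $(H^{d'})^{coH}$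 denote the equalizer of $\rho$ and $H^{d'}\otimes\eta: H^{d'}\to H^{d'}\otimes H$. Suppose that $\mathcal C$ has equalizers, or that the equalizer $(H^{d'})^{coH}$ exists in $\mathcal C$. Then $(H^{d'},\leftharpoondown,\rho)$ is an $H$-Hopf module and $$H^{d'}\cong (H^{d'})^{coH}\otimes H\quad\text{as $H$-Hopf modules in }\mathcal C,$$ where $(H^{d'})^{coH}\otimes H$ has action $(H^{d'})^{coH}\otimes m$ and coaction $(H^{d'})^{coH}\otimes\Delta$. -/

import Mathlib

open CategoryTheory MonoidalCategory CategoryTheory.Limits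
open scoped MonObj ComonObj HopfObj

universe v u

namespace BraidedHopf

section HopfModules

variable {C : Type u} [Category.{v} C] [MonoidalCategory C] [BraidedCategory C]

/-- `act : X ⊗ H ⟶ X` and `coact : X ⟶ X ⊗ H` make `X` a (right, right) `H`-Hopf module:
`X` is a right `H`-module, a right `H`-comodule, and
`coact ∘ act = (act ⊗ m) (X ⊗ C_{H,H} ⊗ H) (coact ⊗ Δ)`. -/
structure IsHopfModule (H : C) [HopfObj H] {X : C} (act : X ⊗ H ⟶ X) (coact : X ⟶ X ⊗ H) :
    Prop where
  act_one : X ◁ η[H] ≫ act = (ρ_ X).hom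
  act_mul : X ◁ μ[H] ≫ act = (α_ X H H).inv ≫ act ▷ H ≫ act
  coact_counit : coact ≫ X ◁ ε[H] = (ρ_ X).inv
  coact_comul : coact ≫ X ◁ Δ[H] = coact ≫ coact ▷ H ≫ (α_ X H H).hom
  act_coact : act ≫ coact = (coact ⊗ₘ Δ[H]) ≫ tensorμ X H H H ≫ (act ⊗ₘ μ[H])

/-- An `H`-Hopf module in `C`. -/
structure HopfModule (H : C) [HopfObj H] where
  X : C
  act : X ⊗ H ⟶ X
  coact : X ⟶ X ⊗ H
  isHopfModule : IsHopfModule H act coact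

namespace HopfModule

variable {H : C} [HopfObj H]

/-- A morphism of Hopf modules: a morphism that is both `H`-linear and `H`-colinear. -/
@[ext]
structure Hom (M N : HopfModule H) where
  hom : M.X ⟶ N.X
  act_hom : M.act ≫ hom = hom ▷ H ≫ N.act
  hom_coact : hom ≫ N.coact = M.coact ≫ hom ▷ H

instance : Category (HopfModule H) where
  Hom M N := Hom M N
  id M := ⟨𝟙 M.X, by simp, by simp⟩
  comp f g := ⟨f.hom ≫ g.hom,
    by rw [← Category.assoc, f.act_hom, Category.assoc, g.act_hom, comp_whiskerRight,
      Category.assoc],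
    by rw [Category.assoc, g.hom_coact, ← Category.assoc, f.hom_coact, comp_whiskerRight,
      Category.assoc]⟩
  id_comp f := Hom.ext (Category.id_comp f.hom)
  comp_id f := Hom.ext (Category.comp_id f.hom)
  assoc f g h := Hom.ext (Category.assoc f.hom g.hom h.hom)

variable (H) in
/-- For an object `V`, the Hopf module `V ⊗ H`, with action `V ⊗ m` and coaction `V ⊗ Δ`. -/
def free (V : C) : HopfModule H where
  X := V ⊗ H
  act := (α_ V H H).hom ≫ V ◁ μ[H]
  coact := V ◁ Δ[H] ≫ (α_ V H H).inv
  isHopfModule :=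
    { act_one := by
        have h : V ◁ (H ◁ η[H] ≫ μ[H]) = V ◁ (ρ_ H).hom := by rw [MonObj.mul_one]
        rw [MonoidalCategory.whiskerLeft_comp] at h
        simp [h]
      act_mul := by
        have h := congrArg (fun f => V ◁ f) (MonObj.mul_assoc_flip H)
        simp only [MonoidalCategory.whiskerLeft_comp] at h
        simp [h]
      coact_counit := by
        have h : V ◁ (Δ[H] ≫ H ◁ ε[H]) = V ◁ (ρ_ H).inv := by rw [ComonObj.comul_counit]
        rw [MonoidalCategory.whiskerLeft_comp] at h
        simp [reassoc_of% h]
      coact_comul := by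
        have h := congrArg (fun f => V ◁ f) (ComonObj.comul_assoc H)
        simp only [MonoidalCategory.whiskerLeft_comp] at h
        simp [reassoc_of% h]
      act_coact := by
        have h := congrArg (fun f => V ◁ f) (BimonObj.mul_comul H)
        simp only [MonoidalCategory.whiskerLeft_comp] at h
        simp only [Category.assoc, reassoc_of% h]
        simp only [tensorμ, MonoidalCategory.tensorHom_def]
        simp
        monoidal }

end HopfModule

/-- The coinvariants of a coaction `coact : X ⟶ X ⊗ H` exist as an object of `C`. -/
abbrev HasCoinvariants {H : C} [HopfObj H] {X : C} (coact : X ⟶ X ⊗ H) : Prop :=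
  HasEqualizer coact ((ρ_ X).inv ≫ X ◁ η[H])

/-- The coinvariants: the equalizer of `coact` and `X ⊗ η`. -/
noncomputable abbrev coinvariants {H : C} [HopfObj H] {X : C} (coact : X ⟶ X ⊗ H)
    [HasCoinvariants coact] : C :=
  equalizer coact ((ρ_ X).inv ≫ X ◁ η[H])

end HopfModules

section QuasiDuals

variable {C : Type u} [Category.{v} C] [MonoidalCategory C] [BraidedCategory C]

/-- The algebra `N` is a left quasi-dual of `H` under the pairing `ev : N ⊗ H ⟶ I`. -/
structure IsQuasiDual {H N : C} [HopfObj H] [MonObj N] (ev : N ⊗ H ⟶ 𝟙_ C) : Prop where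
  mul_ev : μ[N] ▷ H ≫ ev =
    (N ⊗ N) ◁ Δ[H] ≫ tensorμ N N H H ≫ (ev ⊗ₘ ev) ≫ (λ_ (𝟙_ C)).hom
  one_ev : η[N] ▷ H ≫ ev = (λ_ H).hom ≫ ε[H]

/-- The algebra `N` is a faithful quasi-dual of `H` under the pairing `ev`. -/
structure IsFaithfulQuasiDual {H N : C} [HopfObj H] [MonObj N] (ev : N ⊗ H ⟶ 𝟙_ C) : Prop
    extends IsQuasiDual ev where
  faithful_left : ∀ (U V : C) (f f' : U ⟶ V ⊗ N),
    f ▷ H ≫ (α_ V N H).hom ≫ V ◁ ev = f' ▷ H ≫ (α_ V N H).hom ≫ V ◁ ev → f = f'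
  faithful_right : ∀ (U V : C) (g g' : U ⟶ H ⊗ V),
    N ◁ g ≫ (α_ N H V).inv ≫ ev ▷ V = N ◁ g' ≫ (α_ N H V).inv ≫ ev ▷ V → g = g'

/-- A left ideal of the algebra `N`: a subobject `incl : X ⟶ N` such that the multiplication of `N`
restricts to a morphism `N ⊗ X ⟶ X`. -/
structure LeftIdeal (N : C) [MonObj N] where
  X : C
  incl : X ⟶ N
  mono_incl : Mono incl
  mul : N ⊗ X ⟶ X
  mul_incl : mul ≫ incl = N ◁ incl ≫ μ[N]

/-- A strict quasi-dual `L.X` of `H`, where the algebra `N` pairs with `H` by `ev` (to be used for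
a faithful quasi-dual `N`): a left ideal `L` of `N`, a morphism `harp : H ⊗ N ⟶ N` with
`⟨h ⇀ f, x⟩ = ⟨f, x h⟩`, whose restriction to `H ⊗ L` takes values in `L`, and a morphism
`coact : L ⟶ L ⊗ H` with `n f = f₀ ⟨n, f₁⟩` for `n` in `N` and `f` in `L`. -/
structure StrictQuasiDual {H N : C} [HopfObj H] [MonObj N] (ev : N ⊗ H ⟶ 𝟙_ C) where
  L : LeftIdeal N
  harp : H ⊗ N ⟶ N
  coact : L.X ⟶ L.X ⊗ H
  harp_ev : harp ▷ H ≫ ev =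
    (β_ H N).hom ▷ H ≫ (α_ N H H).hom ≫ N ◁ (β_ H H).hom ≫ N ◁ μ[H] ≫ ev
  coact_ev : N ◁ coact ≫ (α_ N L.X H).inv ≫ (β_ N L.X).hom ▷ H ≫ (α_ L.X N H).hom ≫
    L.X ◁ ev ≫ (ρ_ L.X).hom = L.mul
  harpL : H ⊗ L.X ⟶ L.X
  harpL_incl : harpL ≫ L.incl = H ◁ L.incl ≫ harp

/-- The right action `↼ = ⇀ (S ⊗ L) C_{L,H}` of `H` on the strict quasi-dual `L`. -/
def StrictQuasiDual.act {H N : C} [HopfObj H] [MonObj N] {ev : N ⊗ H ⟶ 𝟙_ C}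
    (D : StrictQuasiDual ev) : D.L.X ⊗ H ⟶ D.L.X :=
  (β_ D.L.X H).hom ≫ 𝒮[H] ▷ D.L.X ≫ D.harpL

end QuasiDuals

end BraidedHopf

/-
Every Hopf module `X` is free on its coinvariants: `x ↦ x₀ S(x₁)` maps `X` to the coinvariants, and
`x ↦ x₀ S(x₁) ⊗ x₂` is inverse to the action.

For the strict quasi-dual `L`, a left ideal of the algebra `N` paired with `H`, faithfulness reduces
each module and comodule axiom to an identity between pairings. It also shows that an object whose
double braiding with `H` is trivial has trivial double braiding with `N`; this applies to `H`, and
then to `L`. The compatibility of action and coaction becomes the identity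
`n (S(h) ⇀ f) = S(h₁) ⇀ ((h₂ ⇀ n) f)` for `n` in `N` and `f` in `L`, which holds because `⇀` makes
`N` a module algebra: `S(h₁) ⇀ ((h₂ ⇀ n) f) = (S(h₂) ⇀ (h₃ ⇀ n)) (S(h₁) ⇀ f)`.
-/

namespace BraidedHopf

section HopfModules

variable {C : Type u} [Category.{v} C] [MonoidalCategory C] [BraidedCategory C]

/-- `S(h₂)₁ ⊗ h₁ S(h₂)₂ = S(h) ⊗ 1`. -/
lemma comul_antipode_comul_braiding_mul (H : C) [HopfObj H] :
    Δ[H] ≫ H ◁ (𝒮[H] ≫ Δ[H]) ⊗≫ (β_ H H).hom ▷ H ⊗≫ H ◁ μ[H] = 𝒮[H] ⊗≫ H ◁ η[H] :=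
  calc
    _ = (Δ[H] ≫ H ◁ Δ[H]) ⊗≫ (H ⊗ H) ◁ 𝒮[H] ⊗≫ (H ◁ 𝒮[H]) ▷ H ⊗≫
        (β_ (H ⊗ H) H).hom ≫ H ◁ μ[H] := by
      rw [HopfObj.antipode_comul, ← BraidedCategory.braiding_naturality,
        MonoidalCategory.tensorHom_def', BraidedCategory.braiding_tensor_left_hom]
      monoidal
    _ = Δ[H] ≫ Δ[H] ▷ H ⊗≫ ((H ⊗ H) ◁ 𝒮[H] ≫ (H ◁ 𝒮[H] ≫ μ[H]) ▷ H) ≫ (β_ H H).hom := by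
      rw [ComonObj.comul_assoc, ← BraidedCategory.braiding_naturality_left]
      monoidal
    _ = Δ[H] ≫ (Δ[H] ≫ H ◁ 𝒮[H] ≫ μ[H]) ▷ H ≫ H ◁ 𝒮[H] ≫ (β_ H H).hom := by
      rw [whisker_exchange]
      monoidal
    _ = (Δ[H] ≫ ε[H] ▷ H) ≫ (η[H] ▷ H ≫ H ◁ 𝒮[H]) ≫ (β_ H H).hom := by
      rw [HopfObj.antipode_right]
      monoidal
    _ = 𝒮[H] ⊗≫ H ◁ η[H] := by
      rw [ComonObj.counit_comul, ← whisker_exchange, Category.assoc,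
        BraidedCategory.braiding_naturality_left, braiding_tensorUnit_left]
      monoidal

/-- The endomorphism `x ↦ x₀ S(x₁)` of a Hopf module, which projects it onto its coinvariants. -/
def coinvariantsEndo {H X : C} [HopfObj H] (act : X ⊗ H ⟶ X) (coact : X ⟶ X ⊗ H) : X ⟶ X :=
  coact ≫ X ◁ 𝒮[H] ≫ act

namespace IsHopfModule

variable {H : C} [HopfObj H] {X : C} {act : X ⊗ H ⟶ X} {coact : X ⟶ X ⊗ H}

lemma coinvariantsEndo_coact (h : IsHopfModule H act coact) :
    coinvariantsEndo act coact ≫ coact =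
      coinvariantsEndo act coact ≫ (ρ_ X).inv ≫ X ◁ η[H] :=
  calc
    _ = coact ≫ X ◁ 𝒮[H] ≫ (X ◁ Δ[H] ≫ coact ▷ (H ⊗ H)) ≫ tensorμ X H H H ≫
        act ▷ (H ⊗ H) ≫ X ◁ μ[H] := by
      rw [coinvariantsEndo, Category.assoc, Category.assoc, h.act_coact,
        MonoidalCategory.tensorHom_def', MonoidalCategory.tensorHom_def]
    _ = coact ≫ (X ◁ (𝒮[H] ≫ Δ[H]) ≫ coact ▷ (H ⊗ H)) ⊗≫ X ◁ (β_ H H).hom ▷ H ⊗≫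
        act ▷ (H ⊗ H) ≫ X ◁ μ[H] := by
      rw [tensorμ]
      monoidal
    _ = (coact ≫ coact ▷ H ≫ (α_ X H H).hom) ⊗≫ X ◁ H ◁ (𝒮[H] ≫ Δ[H]) ⊗≫
        X ◁ (β_ H H).hom ▷ H ⊗≫ (act ▷ (H ⊗ H) ≫ X ◁ μ[H]) := by
      rw [whisker_exchange]
      monoidal
    _ = coact ≫ X ◁ (Δ[H] ≫ H ◁ (𝒮[H] ≫ Δ[H]) ⊗≫ (β_ H H).hom ▷ H ⊗≫ H ◁ μ[H]) ⊗≫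
        act ▷ H := by
      rw [← h.coact_comul, ← whisker_exchange]
      monoidal
    _ = coact ≫ X ◁ 𝒮[H] ⊗≫ ((X ⊗ H) ◁ η[H] ≫ act ▷ H) := by
      rw [comul_antipode_comul_braiding_mul]
      monoidal
    _ = _ := by
      rw [whisker_exchange, coinvariantsEndo]
      monoidal

lemma coinvariant_act_coact (h : IsHopfModule H act coact) {E : C} {i : E ⟶ X}
    (hi : i ≫ coact = i ≫ (ρ_ X).inv ≫ X ◁ η[H]) :
    i ▷ H ≫ act ≫ coact = E ◁ Δ[H] ≫ (α_ E H H).inv ≫ (i ▷ H ≫ act) ▷ H :=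
  calc
    _ = (i ▷ H ≫ coact ▷ H) ≫ (X ⊗ H) ◁ Δ[H] ≫ tensorμ X H H H ≫ (act ⊗ₘ μ[H]) := by
      rw [h.act_coact, MonoidalCategory.tensorHom_def]
      simp only [Category.assoc]
    _ = i ▷ H ⊗≫ X ◁ (η[H] ▷ H ≫ H ◁ Δ[H]) ⊗≫ X ◁ (β_ H H).hom ▷ H ⊗≫
        (act ▷ (H ⊗ H) ≫ X ◁ μ[H]) := by
      rw [← comp_whiskerRight, hi, tensorμ, MonoidalCategory.tensorHom_def]
      monoidal
    _ = (i ▷ H ≫ X ◁ Δ[H]) ⊗≫ X ◁ (η[H] ▷ H ≫ (β_ H H).hom) ▷ H ⊗≫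
        X ◁ H ◁ μ[H] ⊗≫ act ▷ H := by
      rw [← whisker_exchange, ← whisker_exchange]
      monoidal
    _ = (E ◁ Δ[H] ≫ i ▷ (H ⊗ H)) ⊗≫ X ◁ H ◁ (η[H] ▷ H ≫ μ[H]) ⊗≫ act ▷ H := by
      rw [whisker_exchange, BraidedCategory.braiding_naturality_left, braiding_tensorUnit_left]
      monoidal
    _ = _ := by
      rw [MonObj.one_mul]
      monoidal

lemma coinvariant_act_coinvariantsEndo (h : IsHopfModule H act coact) {E : C} {i : E ⟶ X}
    (hi : i ≫ coact = i ≫ (ρ_ X).inv ≫ X ◁ η[H]) :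
    i ▷ H ≫ act ≫ coinvariantsEndo act coact = E ◁ ε[H] ≫ (ρ_ E).hom ≫ i :=
  calc
    _ = (i ▷ H ≫ act ≫ coact) ≫ X ◁ 𝒮[H] ≫ act := by
      simp only [coinvariantsEndo, Category.assoc]
    _ = E ◁ Δ[H] ⊗≫ i ▷ H ▷ H ⊗≫ (act ▷ H ≫ X ◁ 𝒮[H]) ≫ act := by
      rw [h.coinvariant_act_coact hi]
      monoidal
    _ = E ◁ Δ[H] ⊗≫ i ▷ (H ⊗ H) ≫ X ◁ H ◁ 𝒮[H] ≫ ((α_ X H H).inv ≫ act ▷ H ≫ act) := by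
      rw [← whisker_exchange]
      monoidal
    _ = E ◁ Δ[H] ⊗≫ (i ▷ (H ⊗ H) ≫ X ◁ (H ◁ 𝒮[H] ≫ μ[H])) ≫ act := by
      rw [← h.act_mul]
      monoidal
    _ = E ◁ (Δ[H] ≫ H ◁ 𝒮[H] ≫ μ[H]) ≫ i ▷ H ≫ act := by
      rw [← whisker_exchange]
      monoidal
    _ = E ◁ ε[H] ≫ i ▷ (𝟙_ C) ≫ X ◁ η[H] ≫ act := by
      rw [HopfObj.antipode_right, ← whisker_exchange_assoc]
      monoidal
    _ = _ := by
      rw [h.act_one]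
      monoidal

lemma coact_coinvariantsEndo_act (h : IsHopfModule H act coact) :
    coact ≫ coinvariantsEndo act coact ▷ H ≫ act = 𝟙 X :=
  calc
    _ = (coact ≫ coact ▷ H ≫ (α_ X H H).hom) ⊗≫ X ◁ 𝒮[H] ▷ H ⊗≫
        ((α_ X H H).inv ≫ act ▷ H ≫ act) := by
      rw [coinvariantsEndo]
      monoidal
    _ = coact ≫ X ◁ (Δ[H] ≫ 𝒮[H] ▷ H ≫ μ[H]) ≫ act := by
      rw [← h.coact_comul, ← h.act_mul]
      monoidal
    _ = (coact ≫ X ◁ ε[H]) ≫ X ◁ η[H] ≫ act := by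
      rw [HopfObj.antipode_left]
      monoidal
    _ = 𝟙 X := by
      rw [h.coact_counit, h.act_one, Iso.inv_hom_id]

end IsHopfModule

/-- An isomorphism of the underlying objects that is linear and colinear is an isomorphism of Hopf
modules. -/
def HopfModule.isoMk {H : C} [HopfObj H] {M N : HopfModule H} (e : M.X ≅ N.X)
    (act_hom : M.act ≫ e.hom = e.hom ▷ H ≫ N.act)
    (hom_coact : e.hom ≫ N.coact = M.coact ≫ e.hom ▷ H) : M ≅ N where
  hom := ⟨e.hom, act_hom, hom_coact⟩
  inv := ⟨e.inv,
    by rw [← cancel_mono e.hom, Category.assoc, Category.assoc, act_hom]; simp,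
    by rw [← cancel_epi e.hom, reassoc_of% hom_coact]; simp⟩
  hom_inv_id := HopfModule.Hom.ext e.hom_inv_id
  inv_hom_id := HopfModule.Hom.ext e.inv_hom_id

theorem IsHopfModule.nonempty_iso_free {H X : C} [HopfObj H] {act : X ⊗ H ⟶ X}
    {coact : X ⟶ X ⊗ H} (h : IsHopfModule H act coact) [HasCoinvariants coact] :
    Nonempty ((⟨X, act, coact, h⟩ : HopfModule H) ≅
      HopfModule.free H (coinvariants coact)) := by
  let E := coinvariants coact
  let i : E ⟶ X := equalizer.ι _ _
  have hi : i ≫ coact = i ≫ (ρ_ X).inv ≫ X ◁ η[H] := equalizer.condition _ _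
  let p : X ⟶ E := equalizer.lift (coinvariantsEndo act coact) h.coinvariantsEndo_coact
  have p_i : p ≫ i = coinvariantsEndo act coact := equalizer.lift_ι _ _
  have act_p : i ▷ H ≫ act ≫ p = E ◁ ε[H] ≫ (ρ_ E).hom := by
    rw [← cancel_mono i]
    simpa [p_i] using h.coinvariant_act_coinvariantsEndo hi
  have coact_act : (coact ≫ p ▷ H) ≫ i ▷ H ≫ act = 𝟙 X := by
    rw [Category.assoc, ← comp_whiskerRight_assoc, p_i, h.coact_coinvariantsEndo_act]
  have act_coact : (i ▷ H ≫ act) ≫ coact ≫ p ▷ H = 𝟙 (E ⊗ H) :=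
    calc
      _ = (i ▷ H ≫ act ≫ coact) ≫ p ▷ H := by simp only [Category.assoc]
      _ = E ◁ Δ[H] ≫ (α_ E H H).inv ≫ (i ▷ H ≫ act ≫ p) ▷ H := by
        rw [h.coinvariant_act_coact hi]
        simp only [Category.assoc, comp_whiskerRight]
      _ = E ◁ (Δ[H] ≫ ε[H] ▷ H) ⊗≫ 𝟙 (E ⊗ H) := by
        rw [act_p]
        monoidal
      _ = 𝟙 (E ⊗ H) := by
        rw [ComonObj.counit_comul]
        monoidal
  refine ⟨(HopfModule.isoMk (M := HopfModule.free H E) (N := ⟨X, act, coact, h⟩)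
    ⟨i ▷ H ≫ act, coact ≫ p ▷ H, act_coact, coact_act⟩ ?_ ?_).symm⟩
  · calc
      _ = (α_ E H H).hom ≫ i ▷ (H ⊗ H) ≫ X ◁ μ[H] ≫ act := by
        simp only [HopfModule.free, Category.assoc, whisker_exchange_assoc]
      _ = (i ▷ H ≫ act) ▷ H ≫ act := by
        rw [h.act_mul]
        monoidal
  · simpa only [HopfModule.free, Category.assoc] using h.coinvariant_act_coact hi

end HopfModules

section Pairings

variable {C : Type u} [Category.{v} C] [MonoidalCategory C] [BraidedCategory C]

/-- `X` and `Y` centralize each other (in the sense of Müger) if their double braiding is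
trivial. -/
def Centralizes (X Y : C) : Prop :=
  (β_ X Y).hom ≫ (β_ Y X).hom = 𝟙 (X ⊗ Y)

lemma Centralizes.symm {X Y : C} (h : Centralizes X Y) : Centralizes Y X := by
  rw [Centralizes, (Iso.hom_comp_eq_id _).mp h, Iso.inv_hom_id]

lemma Centralizes.of_mono {X Y Z : C} (h : Centralizes X Z) (f : Y ⟶ Z) [Mono (X ◁ f)] :
    Centralizes X Y := by
  rw [Centralizes, ← cancel_mono (X ◁ f), Category.assoc,
    ← BraidedCategory.braiding_naturality_left, ← BraidedCategory.braiding_naturality_right_assoc,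
    h, Category.comp_id, Category.id_comp]

lemma braiding_tensor_tensorμ {X₁ X₂ Y₁ Y₂ : C} (h : Centralizes X₁ Y₂) :
    (β_ (X₁ ⊗ X₂) (Y₁ ⊗ Y₂)).hom ≫ tensorμ Y₁ Y₂ X₁ X₂ =
      tensorμ X₁ X₂ Y₁ Y₂ ≫ ((β_ X₁ Y₁).hom ⊗ₘ (β_ X₂ Y₂).hom) :=
  calc
    _ = 𝟙 _ ⊗≫ X₁ ◁ (β_ X₂ Y₁).hom ▷ Y₂ ⊗≫ ((X₁ ⊗ Y₁) ◁ (β_ X₂ Y₂).hom ≫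
        (β_ X₁ Y₁).hom ▷ (Y₂ ⊗ X₂)) ⊗≫ Y₁ ◁ ((β_ X₁ Y₂).hom ≫ (β_ Y₂ X₁).hom) ▷ X₂ ⊗≫ 𝟙 _ := by
      rw [BraidedCategory.braiding_tensor_left_hom, BraidedCategory.braiding_tensor_right_hom,
        BraidedCategory.braiding_tensor_right_hom, tensorμ]
      monoidal
    _ = _ := by
      rw [h, whisker_exchange, tensorμ, MonoidalCategory.tensorHom_def]
      monoidal

namespace IsFaithfulQuasiDual

variable {H N : C} [HopfObj H] [MonObj N] {ev : N ⊗ H ⟶ 𝟙_ C}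

lemma centralizes (hev : IsFaithfulQuasiDual ev) {B : C} (h : Centralizes B H) :
    Centralizes B N := by
  refine hev.faithful_left _ _ _ _ ?_
  calc
    _ = 𝟙 _ ⊗≫ (β_ B N).hom ▷ H ⊗≫ N ◁ ((β_ B H).hom ≫ (β_ H B).hom) ⊗≫
        (β_ N B).hom ▷ H ⊗≫ B ◁ ev := by
      rw [h]
      monoidal
    _ = (α_ B N H).hom ≫ (β_ B (N ⊗ H)).hom ≫ (β_ (N ⊗ H) B).hom ≫ B ◁ ev := by
      rw [BraidedCategory.braiding_tensor_left_hom, BraidedCategory.braiding_tensor_right_hom]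
      monoidal
    _ = _ := by
      rw [← BraidedCategory.braiding_naturality_left,
        ← BraidedCategory.braiding_naturality_right_assoc, braiding_tensorUnit_left,
        braiding_tensorUnit_right]
      monoidal

lemma mono_whiskerLeft (hev : IsFaithfulQuasiDual ev) {X Y : C} (f : X ⟶ Y) [Mono f] :
    Mono (H ◁ f) where
  right_cancellation g g' h := by
    have : Mono (𝟙_ C ◁ f) := by
      rw [id_whiskerLeft]
      infer_instance
    refine hev.faithful_right _ _ _ _ ?_
    rw [← cancel_mono (𝟙_ C ◁ f)]
    simp only [Category.assoc, ← whisker_exchange]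
    rw [← associator_inv_naturality_right_assoc, ← MonoidalCategory.whiskerLeft_comp_assoc, h]
    simp

end IsFaithfulQuasiDual

/-- The pairing `⟨,⟩` with its arguments swapped by the braiding. Since `H` then stands on the left
of `N`, it relates the left action `⇀` of `H` on `N` to the multiplication of `H`. -/
def flipPairing {H N : C} (ev : N ⊗ H ⟶ 𝟙_ C) : H ⊗ N ⟶ 𝟙_ C :=
  (β_ H N).hom ≫ ev

/-- Both sides are `⟨p, h₁⟩ ⟨n, h₂⟩` on `h₁ ⊗ h₂ ⊗ n ⊗ p`. -/
lemma braiding_tensorμ_flipPairing {H N : C} (ev : N ⊗ H ⟶ 𝟙_ C) :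
    (H ⊗ H) ◁ (β_ N N).hom ≫ tensorμ H H N N ≫ (flipPairing ev ⊗ₘ flipPairing ev) ≫
        (λ_ (𝟙_ C)).hom =
      𝟙 _ ⊗≫ H ◁ flipPairing ev ▷ N ⊗≫ flipPairing ev :=
  calc
    _ = 𝟙 _ ⊗≫ H ◁ ((β_ (H ⊗ N) N).hom ≫ N ◁ flipPairing ev) ⊗≫ flipPairing ev := by
      rw [BraidedCategory.braiding_tensor_left_hom, tensorμ, MonoidalCategory.tensorHom_def']
      monoidal
    _ = _ := by
      rw [← BraidedCategory.braiding_naturality_left, braiding_tensorUnit_left]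
      monoidal

lemma IsQuasiDual.whiskerLeft_mul_flipPairing {H N : C} [HopfObj H] [MonObj N]
    {ev : N ⊗ H ⟶ 𝟙_ C} (hev : IsQuasiDual ev) (hHN : Centralizes H N) :
    H ◁ μ[N] ≫ flipPairing ev = Δ[H] ▷ (N ⊗ N) ≫ tensorμ H H N N ≫
      (flipPairing ev ⊗ₘ flipPairing ev) ≫ (λ_ (𝟙_ C)).hom := by
  rw [flipPairing, BraidedCategory.braiding_naturality_right_assoc, hev.mul_ev,
    ← BraidedCategory.braiding_naturality_left_assoc, reassoc_of% braiding_tensor_tensorμ hHN,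
    tensorHom_comp_tensorHom_assoc]

lemma IsQuasiDual.whiskerLeft_one_flipPairing {H N : C} [HopfObj H] [MonObj N]
    {ev : N ⊗ H ⟶ 𝟙_ C} (hev : IsQuasiDual ev) :
    H ◁ η[N] ≫ flipPairing ev = (ρ_ H).hom ≫ ε[H] := by
  rw [flipPairing, BraidedCategory.braiding_naturality_right_assoc, hev.one_ev,
    braiding_tensorUnit_right]
  simp only [Category.assoc, Iso.inv_hom_id_assoc]

namespace IsFaithfulQuasiDual

variable {H N : C} [HopfObj H] [MonObj N] {ev : N ⊗ H ⟶ 𝟙_ C}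

lemma hom_ext_right (hev : IsFaithfulQuasiDual ev) {U : C} {f f' : U ⟶ N}
    (h : H ◁ f ≫ flipPairing ev = H ◁ f' ≫ flipPairing ev) : f = f' := by
  have pairing_eq : f ▷ H ≫ ev = f' ▷ H ≫ ev := by
    simpa only [flipPairing, BraidedCategory.braiding_naturality_right_assoc,
      cancel_epi] using h
  rw [← cancel_mono (λ_ N).inv]
  refine hev.faithful_left _ _ _ _ ?_
  calc
    _ = (f ▷ H ≫ ev) ⊗≫ 𝟙 _ := by monoidal
    _ = (f' ▷ H ≫ ev) ⊗≫ 𝟙 _ := by rw [pairing_eq]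
    _ = _ := by monoidal

lemma hom_ext_left (hev : IsFaithfulQuasiDual ev) {U V : C} {g g' : U ⟶ V ⊗ H}
    (h : g ▷ N ≫ (α_ V H N).hom ≫ V ◁ flipPairing ev ≫ (ρ_ V).hom =
      g' ▷ N ≫ (α_ V H N).hom ≫ V ◁ flipPairing ev ≫ (ρ_ V).hom) : g = g' := by
  rw [← cancel_mono (β_ V H).hom]
  refine hev.faithful_right _ _ _ _ ?_
  have pairing_eq (k : U ⟶ V ⊗ H) : (β_ U N).hom ≫ N ◁ (k ≫ (β_ V H).hom) ≫
      (α_ N H V).inv ≫ ev ▷ V = (k ▷ N ≫ (α_ V H N).hom ≫ V ◁ flipPairing ev ≫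
        (ρ_ V).hom) ≫ (λ_ V).inv :=
    calc
      _ = k ▷ N ≫ (β_ (V ⊗ H) N).hom ≫ N ◁ (β_ V H).hom ≫ (α_ N H V).inv ≫ ev ▷ V := by
        rw [MonoidalCategory.whiskerLeft_comp, Category.assoc,
          ← BraidedCategory.braiding_naturality_left_assoc]
      _ = k ▷ N ⊗≫ V ◁ (β_ H N).hom ⊗≫ (β_ V (N ⊗ H)).hom ≫ ev ▷ V := by
        rw [BraidedCategory.braiding_tensor_left_hom, BraidedCategory.braiding_tensor_right_hom]
        monoidal
      _ = _ := by
        rw [← BraidedCategory.braiding_naturality_right, braiding_tensorUnit_right, flipPairing]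
        monoidal
  rw [← cancel_epi (β_ U N).hom, pairing_eq, pairing_eq, h]

lemma hom_ext_left₂ (hev : IsFaithfulQuasiDual ev) {U V : C} {g g' : U ⟶ V ⊗ H ⊗ H}
    (h : g ▷ (N ⊗ N) ⊗≫ V ◁ (tensorμ H H N N ≫ (flipPairing ev ⊗ₘ flipPairing ev) ≫
        (λ_ (𝟙_ C)).hom) ≫ (ρ_ V).hom =
      g' ▷ (N ⊗ N) ⊗≫ V ◁ (tensorμ H H N N ≫ (flipPairing ev ⊗ₘ flipPairing ev) ≫
        (λ_ (𝟙_ C)).hom) ≫ (ρ_ V).hom) : g = g' := by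
  have pairing_eq (k : U ⟶ V ⊗ H ⊗ H) :
      ((k ≫ (α_ V H H).inv) ▷ N ≫ (α_ (V ⊗ H) H N).hom ≫ (V ⊗ H) ◁ flipPairing ev ≫
        (ρ_ (V ⊗ H)).hom) ▷ N ≫ (α_ V H N).hom ≫ V ◁ flipPairing ev ≫ (ρ_ V).hom =
      (α_ U N N).hom ≫ U ◁ (β_ N N).hom ≫ (k ▷ (N ⊗ N) ⊗≫ V ◁ (tensorμ H H N N ≫
        (flipPairing ev ⊗ₘ flipPairing ev) ≫ (λ_ (𝟙_ C)).hom) ≫ (ρ_ V).hom) :=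
    calc
      _ = (α_ U N N).hom ≫ k ▷ (N ⊗ N) ⊗≫ V ◁ ((H ⊗ H) ◁ (β_ N N).hom ≫ tensorμ H H N N ≫
          (flipPairing ev ⊗ₘ flipPairing ev) ≫ (λ_ (𝟙_ C)).hom) ≫ (ρ_ V).hom := by
        rw [braiding_tensorμ_flipPairing]
        monoidal
      _ = (α_ U N N).hom ≫ (k ▷ (N ⊗ N) ≫ (V ⊗ H ⊗ H) ◁ (β_ N N).hom) ⊗≫ V ◁ (tensorμ H H N N ≫
          (flipPairing ev ⊗ₘ flipPairing ev) ≫ (λ_ (𝟙_ C)).hom) ≫ (ρ_ V).hom := by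
        monoidal
      _ = _ := by
        rw [← whisker_exchange]
        monoidal
  rw [← cancel_mono (α_ V H H).inv]
  refine hev.hom_ext_left (hev.hom_ext_left ?_)
  rw [pairing_eq, pairing_eq, h]

end IsFaithfulQuasiDual

end Pairings

namespace LeftIdeal

variable {C : Type u} [Category.{v} C] [MonoidalCategory C] {N : C} [MonObj N] (L : LeftIdeal N)

lemma one_mul : η[N] ▷ L.X ≫ L.mul = (λ_ L.X).hom := by
  have := L.mono_incl
  rw [← cancel_mono L.incl, Category.assoc, L.mul_incl, ← whisker_exchange_assoc, MonObj.one_mul,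
    leftUnitor_naturality]

lemma mul_assoc : μ[N] ▷ L.X ≫ L.mul = (α_ N N L.X).hom ≫ N ◁ L.mul ≫ L.mul := by
  have := L.mono_incl
  rw [← cancel_mono L.incl]
  simp only [Category.assoc, L.mul_incl]
  rw [← whisker_exchange_assoc, MonObj.mul_assoc, ← MonoidalCategory.whiskerLeft_comp_assoc,
    L.mul_incl]
  monoidal

end LeftIdeal

namespace StrictQuasiDual

variable {C : Type u} [Category.{v} C] [MonoidalCategory C] [BraidedCategory C]
variable {H N : C} [HopfObj H] [MonObj N] {ev : N ⊗ H ⟶ 𝟙_ C}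

lemma whiskerLeft_harp_flipPairing (D : StrictQuasiDual ev) (hH : Centralizes H H) :
    H ◁ D.harp ≫ flipPairing ev = (α_ H H N).inv ≫ μ[H] ▷ N ≫ flipPairing ev :=
  calc
    _ = (β_ H (H ⊗ N)).hom ≫ (β_ H N).hom ▷ H ⊗≫ N ◁ (β_ H H).hom ≫ N ◁ μ[H] ≫ ev := by
      rw [flipPairing, BraidedCategory.braiding_naturality_right_assoc, D.harp_ev]
      monoidal
    _ = (α_ H H N).inv ≫ (β_ H H).hom ▷ N ≫ (β_ (H ⊗ H) N).hom ≫
        N ◁ ((β_ H H).hom ≫ μ[H]) ≫ ev := by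
      rw [BraidedCategory.braiding_tensor_left_hom, BraidedCategory.braiding_tensor_right_hom]
      monoidal
    _ = (α_ H H N).inv ≫ ((β_ H H).hom ≫ (β_ H H).hom) ▷ N ≫ (β_ (H ⊗ H) N).hom ≫
        N ◁ μ[H] ≫ ev := by
      rw [MonoidalCategory.whiskerLeft_comp, Category.assoc,
        ← BraidedCategory.braiding_naturality_left_assoc]
      monoidal
    _ = _ := by
      rw [hH, id_whiskerRight, Category.id_comp, flipPairing,
        ← BraidedCategory.braiding_naturality_left_assoc]

lemma coact_flipPairing (D : StrictQuasiDual ev) (hLN : Centralizes D.L.X N) :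
    D.coact ▷ N ≫ (α_ D.L.X H N).hom ≫ D.L.X ◁ flipPairing ev ≫ (ρ_ D.L.X).hom =
      (β_ D.L.X N).hom ≫ D.L.mul :=
  calc
    _ = D.coact ▷ N ⊗≫ D.L.X ◁ (β_ H N).hom ⊗≫ ((β_ D.L.X N).hom ≫ (β_ N D.L.X).hom) ▷ H ⊗≫
        D.L.X ◁ ev ≫ (ρ_ D.L.X).hom := by
      rw [hLN, flipPairing]
      monoidal
    _ = (D.coact ▷ N ≫ (β_ (D.L.X ⊗ H) N).hom) ⊗≫ (β_ N D.L.X).hom ▷ H ⊗≫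
        D.L.X ◁ ev ≫ (ρ_ D.L.X).hom := by
      rw [BraidedCategory.braiding_tensor_left_hom]
      monoidal
    _ = _ := by
      rw [BraidedCategory.braiding_naturality_left, ← D.coact_ev]
      monoidal

lemma one_harp (D : StrictQuasiDual ev) (hev : IsFaithfulQuasiDual ev) (hH : Centralizes H H) :
    η[H] ▷ N ≫ D.harp = (λ_ N).hom := by
  refine hev.hom_ext_right ?_
  calc
    _ = H ◁ η[H] ▷ N ≫ (α_ H H N).inv ≫ μ[H] ▷ N ≫ flipPairing ev := by
      rw [MonoidalCategory.whiskerLeft_comp, Category.assoc, D.whiskerLeft_harp_flipPairing hH]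
    _ = 𝟙 _ ⊗≫ (H ◁ η[H] ≫ μ[H]) ▷ N ≫ flipPairing ev := by
      monoidal
    _ = _ := by
      rw [MonObj.mul_one]
      monoidal

lemma mul_harp (D : StrictQuasiDual ev) (hev : IsFaithfulQuasiDual ev) (hH : Centralizes H H) :
    μ[H] ▷ N ≫ D.harp = (α_ H H N).hom ≫ H ◁ D.harp ≫ D.harp := by
  have pairing_eq := D.whiskerLeft_harp_flipPairing hH
  refine hev.hom_ext_right ?_
  calc
    _ = 𝟙 _ ⊗≫ (H ◁ μ[H] ≫ μ[H]) ▷ N ≫ flipPairing ev := by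
      rw [MonoidalCategory.whiskerLeft_comp, Category.assoc, pairing_eq]
      monoidal
    _ = 𝟙 _ ⊗≫ μ[H] ▷ H ▷ N ⊗≫ ((α_ H H N).inv ≫ μ[H] ▷ N ≫ flipPairing ev) := by
      rw [MonObj.mul_assoc_flip]
      monoidal
    _ = 𝟙 _ ⊗≫ (μ[H] ▷ (H ⊗ N) ≫ H ◁ D.harp) ≫ flipPairing ev := by
      rw [← pairing_eq]
      monoidal
    _ = 𝟙 _ ⊗≫ H ◁ H ◁ D.harp ≫ (α_ H H N).inv ≫ μ[H] ▷ N ≫ flipPairing ev := by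
      rw [← whisker_exchange]
      monoidal
    _ = _ := by
      rw [← pairing_eq]
      monoidal

lemma harp_mul (D : StrictQuasiDual ev) (hev : IsFaithfulQuasiDual ev) (hH : Centralizes H H) :
    H ◁ μ[N] ≫ D.harp = Δ[H] ▷ (N ⊗ N) ≫ tensorμ H H N N ≫ (D.harp ⊗ₘ D.harp) ≫ μ[N] := by
  have harp_ev : (α_ H H N).hom ≫ H ◁ D.harp ≫ flipPairing ev = μ[H] ▷ N ≫ flipPairing ev := by
    rw [D.whiskerLeft_harp_flipPairing hH, Iso.hom_inv_id_assoc]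
  have mul_ev := hev.whiskerLeft_mul_flipPairing (hev.centralizes hH)
  refine hev.hom_ext_right ?_
  rw [← cancel_epi (α_ H H (N ⊗ N)).hom]
  calc
    _ = ((H ⊗ H) ◁ μ[N] ≫ μ[H] ▷ N) ≫ flipPairing ev := by
      rw [MonoidalCategory.whiskerLeft_comp, Category.assoc, D.whiskerLeft_harp_flipPairing hH]
      monoidal
    _ = (μ[H] ≫ Δ[H]) ▷ (N ⊗ N) ≫ tensorμ H H N N ≫
        (flipPairing ev ⊗ₘ flipPairing ev) ≫ (λ_ (𝟙_ C)).hom := by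
      rw [whisker_exchange, Category.assoc, mul_ev, comp_whiskerRight_assoc]
    _ = (Δ[H] ⊗ₘ Δ[H]) ▷ (N ⊗ N) ≫ tensorμ H H H H ▷ (N ⊗ N) ≫ tensorμ (H ⊗ H) (H ⊗ H) N N ≫
        ((α_ H H N).hom ⊗ₘ (α_ H H N).hom) ≫ (H ◁ D.harp ⊗ₘ H ◁ D.harp) ≫
        (flipPairing ev ⊗ₘ flipPairing ev) ≫ (λ_ (𝟙_ C)).hom := by
      simp only [BimonObj.mul_comul, comp_whiskerRight, Category.assoc,
        tensorμ_natural_left_assoc, tensorHom_comp_tensorHom_assoc, harp_ev]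
    _ = (α_ H H (N ⊗ N)).hom ≫ (H ◁ Δ[H] ▷ (N ⊗ N) ≫ Δ[H] ▷ ((H ⊗ H) ⊗ N ⊗ N)) ≫
        (H ⊗ H) ◁ (tensorμ H H N N ≫ (D.harp ⊗ₘ D.harp)) ≫ tensorμ H H N N ≫
        (flipPairing ev ⊗ₘ flipPairing ev) ≫ (λ_ (𝟙_ C)).hom := by
      rw [reassoc_of% tensor_associativity, ← tensorμ_natural_right_assoc,
        MonoidalCategory.tensorHom_def']
      monoidal
    _ = (α_ H H (N ⊗ N)).hom ≫ H ◁ Δ[H] ▷ (N ⊗ N) ≫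
        H ◁ (tensorμ H H N N ≫ (D.harp ⊗ₘ D.harp)) ≫ Δ[H] ▷ (N ⊗ N) ≫ tensorμ H H N N ≫
        (flipPairing ev ⊗ₘ flipPairing ev) ≫ (λ_ (𝟙_ C)).hom := by
      rw [Category.assoc, ← whisker_exchange_assoc]
    _ = _ := by
      rw [← mul_ev]
      simp only [MonoidalCategory.whiskerLeft_comp, Category.assoc]

lemma one_harpL (D : StrictQuasiDual ev) (hev : IsFaithfulQuasiDual ev) (hH : Centralizes H H) :
    η[H] ▷ D.L.X ≫ D.harpL = (λ_ D.L.X).hom := by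
  have := D.L.mono_incl
  rw [← cancel_mono D.L.incl, Category.assoc, D.harpL_incl, ← whisker_exchange_assoc,
    D.one_harp hev hH, leftUnitor_naturality]

lemma mul_harpL (D : StrictQuasiDual ev) (hev : IsFaithfulQuasiDual ev) (hH : Centralizes H H) :
    μ[H] ▷ D.L.X ≫ D.harpL = (α_ H H D.L.X).hom ≫ H ◁ D.harpL ≫ D.harpL := by
  have := D.L.mono_incl
  rw [← cancel_mono D.L.incl]
  simp only [Category.assoc, D.harpL_incl]
  rw [← whisker_exchange_assoc, D.mul_harp hev hH, ← MonoidalCategory.whiskerLeft_comp_assoc,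
    D.harpL_incl]
  monoidal

lemma harpL_mul (D : StrictQuasiDual ev) (hev : IsFaithfulQuasiDual ev) (hH : Centralizes H H) :
    H ◁ D.L.mul ≫ D.harpL =
      Δ[H] ▷ (N ⊗ D.L.X) ≫ tensorμ H H N D.L.X ≫ (D.harp ⊗ₘ D.harpL) ≫ D.L.mul := by
  have := D.L.mono_incl
  rw [← cancel_mono D.L.incl]
  have incl_eq : (D.harp ⊗ₘ D.harpL) ≫ N ◁ D.L.incl =
      (H ◁ 𝟙 N ⊗ₘ H ◁ D.L.incl) ≫ (D.harp ⊗ₘ D.harp) := by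
    rw [← id_tensorHom, tensorHom_comp_tensorHom, tensorHom_comp_tensorHom, D.harpL_incl]
    simp
  simp only [Category.assoc, D.harpL_incl, D.L.mul_incl]
  rw [← MonoidalCategory.whiskerLeft_comp_assoc, D.L.mul_incl, reassoc_of% incl_eq,
    ← tensorμ_natural_right_assoc, id_tensorHom, ← whisker_exchange_assoc,
    MonoidalCategory.whiskerLeft_comp_assoc, D.harp_mul hev hH]

/-- The morphism `h ⊗ f ↦ S(h) ⇀ f`, so that `↼` is its composite with the braiding. -/
def antipodeHarp (D : StrictQuasiDual ev) : H ⊗ D.L.X ⟶ D.L.X :=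
  𝒮[H] ▷ D.L.X ≫ D.harpL

/-- `S(h₁) ⇀ (h₂ ⇀ n) = ε(h) n`, with `h₁` kept to the left. -/
lemma comul_antipode_harp_harp (D : StrictQuasiDual ev) (hev : IsFaithfulQuasiDual ev)
    (hH : Centralizes H H) :
    (Δ[H] ▷ N ⊗≫ H ◁ D.harp) ≫ 𝒮[H] ▷ N ≫ D.harp = ε[H] ▷ N ≫ (λ_ N).hom :=
  calc
    _ = Δ[H] ▷ N ⊗≫ (H ◁ D.harp ≫ 𝒮[H] ▷ N) ≫ D.harp := by
      monoidal
    _ = (Δ[H] ≫ 𝒮[H] ▷ H) ▷ N ≫ (α_ H H N).hom ≫ H ◁ D.harp ≫ D.harp := by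
      rw [whisker_exchange]
      monoidal
    _ = (Δ[H] ≫ 𝒮[H] ▷ H ≫ μ[H]) ▷ N ≫ D.harp := by
      rw [← D.mul_harp hev hH]
      monoidal
    _ = _ := by
      rw [HopfObj.antipode_left, comp_whiskerRight, Category.assoc, D.one_harp hev hH]

/-- The module algebra law `S(h) ⇀ (n f) = (S(h₂) ⇀ n) (S(h₁) ⇀ f)`. -/
lemma antipodeHarp_mul (D : StrictQuasiDual ev) (hev : IsFaithfulQuasiDual ev)
    (hH : Centralizes H H) :
    H ◁ D.L.mul ≫ D.antipodeHarp =
      Δ[H] ▷ (N ⊗ D.L.X) ⊗≫ (H ◁ (𝒮[H] ▷ N ≫ D.harp) ≫ (β_ H N).hom) ▷ D.L.X ⊗≫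
        N ◁ D.antipodeHarp ≫ D.L.mul :=
  calc
    _ = (𝒮[H] ≫ Δ[H]) ▷ (N ⊗ D.L.X) ≫ tensorμ H H N D.L.X ≫ (D.harp ⊗ₘ D.harpL) ≫ D.L.mul := by
      rw [antipodeHarp, whisker_exchange_assoc, D.harpL_mul hev hH, comp_whiskerRight_assoc]
    _ = (Δ[H] ≫ H ◁ 𝒮[H] ≫ (β_ H H).hom) ▷ (N ⊗ D.L.X) ⊗≫ H ◁ (𝒮[H] ▷ N ≫ (β_ H N).hom) ▷ D.L.X ⊗≫
        (D.harp ▷ (H ⊗ D.L.X) ≫ N ◁ D.harpL) ≫ D.L.mul := by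
      rw [HopfObj.antipode_comul, MonoidalCategory.tensorHom_def,
        ← BraidedCategory.braiding_naturality_right_assoc, tensorμ,
        MonoidalCategory.tensorHom_def]
      monoidal
    _ = (Δ[H] ≫ H ◁ 𝒮[H] ≫ (β_ H H).hom) ▷ (N ⊗ D.L.X) ⊗≫ H ◁ (β_ H N).hom ▷ D.L.X ⊗≫
        ((H ⊗ N) ◁ 𝒮[H] ▷ D.L.X ≫ D.harp ▷ (H ⊗ D.L.X)) ≫ N ◁ D.harpL ≫ D.L.mul := by
      rw [BraidedCategory.braiding_naturality_left]
      monoidal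
    _ = (Δ[H] ≫ H ◁ 𝒮[H]) ▷ (N ⊗ D.L.X) ⊗≫ ((β_ H (H ⊗ N)).hom ≫ D.harp ▷ H) ▷ D.L.X ⊗≫
        N ◁ D.antipodeHarp ≫ D.L.mul := by
      rw [whisker_exchange, BraidedCategory.braiding_tensor_right_hom, antipodeHarp]
      monoidal
    _ = _ := by
      rw [← BraidedCategory.braiding_naturality_right]
      monoidal

/-- `n (S(h) ⇀ f) = S(h₁) ⇀ ((h₂ ⇀ n) f)`. -/
lemma mul_antipodeHarp (D : StrictQuasiDual ev) (hev : IsFaithfulQuasiDual ev)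
    (hH : Centralizes H H) :
    (β_ H N).hom ▷ D.L.X ⊗≫ N ◁ D.antipodeHarp ≫ D.L.mul =
      (Δ[H] ▷ N ⊗≫ H ◁ D.harp) ▷ D.L.X ⊗≫ H ◁ D.L.mul ≫ D.antipodeHarp := by
  symm
  calc
    _ = 𝟙 _ ⊗≫ Δ[H] ▷ (N ⊗ D.L.X) ⊗≫ (H ◁ D.harp ≫ Δ[H] ▷ N) ▷ D.L.X ⊗≫
        (H ◁ (𝒮[H] ▷ N ≫ D.harp) ≫ (β_ H N).hom) ▷ D.L.X ⊗≫
        N ◁ D.antipodeHarp ≫ D.L.mul := by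
      rw [D.antipodeHarp_mul hev hH]
      monoidal
    _ = 𝟙 _ ⊗≫ (Δ[H] ≫ Δ[H] ▷ H ≫ (α_ H H H).hom) ▷ (N ⊗ D.L.X) ⊗≫
        (H ◁ (H ◁ D.harp ≫ 𝒮[H] ▷ N ≫ D.harp) ≫ (β_ H N).hom) ▷ D.L.X ⊗≫
        N ◁ D.antipodeHarp ≫ D.L.mul := by
      rw [whisker_exchange]
      monoidal
    _ = 𝟙 _ ⊗≫ Δ[H] ▷ (N ⊗ D.L.X) ⊗≫
        (H ◁ ((Δ[H] ▷ N ⊗≫ H ◁ D.harp) ≫ 𝒮[H] ▷ N ≫ D.harp) ≫ (β_ H N).hom) ▷ D.L.X ⊗≫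
        N ◁ D.antipodeHarp ≫ D.L.mul := by
      rw [← ComonObj.comul_assoc]
      monoidal
    _ = 𝟙 _ ⊗≫ (Δ[H] ≫ H ◁ ε[H]) ▷ (N ⊗ D.L.X) ⊗≫ (β_ H N).hom ▷ D.L.X ⊗≫
        N ◁ D.antipodeHarp ≫ D.L.mul := by
      rw [D.comul_antipode_harp_harp hev hH]
      monoidal
    _ = _ := by
      rw [ComonObj.comul_counit]
      monoidal

lemma act_one (D : StrictQuasiDual ev) (hev : IsFaithfulQuasiDual ev) (hH : Centralizes H H) :
    D.L.X ◁ η[H] ≫ D.act = (ρ_ D.L.X).hom := by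
  rw [act, BraidedCategory.braiding_naturality_right_assoc, ← comp_whiskerRight_assoc,
    HopfObj.one_antipode, D.one_harpL hev hH, braiding_tensorUnit_right, Category.assoc,
    Iso.inv_hom_id, Category.comp_id]

lemma act_mul (D : StrictQuasiDual ev) (hev : IsFaithfulQuasiDual ev) (hH : Centralizes H H) :
    D.L.X ◁ μ[H] ≫ D.act = (α_ D.L.X H H).inv ≫ D.act ▷ H ≫ D.act := by
  symm
  calc
    _ = (α_ D.L.X H H).inv ≫ (β_ D.L.X H).hom ▷ H ≫
        ((𝒮[H] ▷ D.L.X ≫ D.harpL) ▷ H ≫ (β_ D.L.X H).hom) ≫ 𝒮[H] ▷ D.L.X ≫ D.harpL := by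
      rw [act]
      monoidal
    _ = (α_ D.L.X H H).inv ≫ (β_ D.L.X H).hom ▷ H ≫ (β_ (H ⊗ D.L.X) H).hom ≫
        H ◁ (𝒮[H] ▷ D.L.X) ≫ (H ◁ D.harpL ≫ 𝒮[H] ▷ D.L.X) ≫ D.harpL := by
      rw [BraidedCategory.braiding_naturality_left]
      monoidal
    _ = (α_ D.L.X H H).inv ≫ ((β_ D.L.X H).hom ▷ H ≫ (β_ (H ⊗ D.L.X) H).hom) ⊗≫
        (H ◁ 𝒮[H] ≫ 𝒮[H] ▷ H) ▷ D.L.X ≫ (α_ H H D.L.X).hom ≫ H ◁ D.harpL ≫ D.harpL := by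
      rw [whisker_exchange]
      monoidal
    _ = (β_ D.L.X (H ⊗ H)).hom ≫ ((β_ H H).hom ≫ (𝒮[H] ⊗ₘ 𝒮[H]) ≫ μ[H]) ▷ D.L.X ≫ D.harpL := by
      rw [← D.mul_harpL hev hH, BraidedCategory.braiding_tensor_left_hom,
        BraidedCategory.braiding_tensor_right_hom, MonoidalCategory.tensorHom_def']
      monoidal
    _ = _ := by
      rw [← BraidedCategory.braiding_naturality_assoc, ← HopfObj.mul_antipode, act,
        BraidedCategory.braiding_naturality_right_assoc, comp_whiskerRight_assoc]

lemma coact_counit (D : StrictQuasiDual ev) (hev : IsQuasiDual ev) (hLN : Centralizes D.L.X N) :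
    D.coact ≫ D.L.X ◁ ε[H] = (ρ_ D.L.X).inv := by
  rw [← cancel_mono (ρ_ D.L.X).hom, ← cancel_epi (ρ_ D.L.X).hom]
  calc
    _ = D.coact ▷ 𝟙_ C ⊗≫ D.L.X ◁ ((ρ_ H).hom ≫ ε[H]) ≫ (ρ_ D.L.X).hom := by
      monoidal
    _ = (D.coact ▷ 𝟙_ C ≫ (D.L.X ⊗ H) ◁ η[N]) ⊗≫ D.L.X ◁ flipPairing ev ≫ (ρ_ D.L.X).hom := by
      rw [← hev.whiskerLeft_one_flipPairing]
      monoidal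
    _ = D.L.X ◁ η[N] ≫ D.coact ▷ N ≫ (α_ D.L.X H N).hom ≫ D.L.X ◁ flipPairing ev ≫
        (ρ_ D.L.X).hom := by
      rw [← whisker_exchange]
      monoidal
    _ = _ := by
      rw [D.coact_flipPairing hLN, BraidedCategory.braiding_naturality_right_assoc, D.L.one_mul,
        braiding_tensorUnit_right]
      monoidal

lemma coact_comul_flipPairing (D : StrictQuasiDual ev) (hev : IsQuasiDual ev)
    (hHN : Centralizes H N) (hLN : Centralizes D.L.X N) :
    (D.coact ≫ D.L.X ◁ Δ[H]) ▷ (N ⊗ N) ⊗≫ D.L.X ◁ (tensorμ H H N N ≫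
        (flipPairing ev ⊗ₘ flipPairing ev) ≫ (λ_ (𝟙_ C)).hom) ≫ (ρ_ D.L.X).hom =
      (β_ D.L.X (N ⊗ N)).hom ≫ μ[N] ▷ D.L.X ≫ D.L.mul :=
  calc
    _ = D.coact ▷ (N ⊗ N) ⊗≫ D.L.X ◁ (Δ[H] ▷ (N ⊗ N) ≫ tensorμ H H N N ≫
        (flipPairing ev ⊗ₘ flipPairing ev) ≫ (λ_ (𝟙_ C)).hom) ≫ (ρ_ D.L.X).hom := by
      monoidal
    _ = (D.coact ▷ (N ⊗ N) ≫ (D.L.X ⊗ H) ◁ μ[N]) ⊗≫ D.L.X ◁ flipPairing ev ≫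
        (ρ_ D.L.X).hom := by
      rw [← hev.whiskerLeft_mul_flipPairing hHN]
      monoidal
    _ = D.L.X ◁ μ[N] ≫ D.coact ▷ N ≫ (α_ D.L.X H N).hom ≫ D.L.X ◁ flipPairing ev ≫
        (ρ_ D.L.X).hom := by
      rw [← whisker_exchange]
      monoidal
    _ = _ := by
      rw [D.coact_flipPairing hLN, BraidedCategory.braiding_naturality_right_assoc]

lemma coact_coact_flipPairing (D : StrictQuasiDual ev) (hLN : Centralizes D.L.X N) :
    (D.coact ≫ D.coact ▷ H ≫ (α_ D.L.X H H).hom) ▷ (N ⊗ N) ⊗≫ D.L.X ◁ (tensorμ H H N N ≫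
        (flipPairing ev ⊗ₘ flipPairing ev) ≫ (λ_ (𝟙_ C)).hom) ≫ (ρ_ D.L.X).hom =
      (β_ D.L.X (N ⊗ N)).hom ≫ (α_ N N D.L.X).hom ≫ N ◁ D.L.mul ≫ D.L.mul :=
  calc
    _ = D.coact ▷ (N ⊗ N) ⊗≫ (D.coact ▷ (H ⊗ N) ≫ (D.L.X ⊗ H) ◁ (β_ H N).hom) ▷ N ⊗≫
        D.L.X ◁ flipPairing ev ▷ (H ⊗ N) ⊗≫ D.L.X ◁ flipPairing ev ≫ (ρ_ D.L.X).hom := by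
      rw [tensorμ, MonoidalCategory.tensorHom_def]
      monoidal
    _ = D.coact ▷ (N ⊗ N) ⊗≫ D.L.X ◁ (β_ H N).hom ▷ N ⊗≫ (D.coact ▷ N ≫ (α_ D.L.X H N).hom ≫
        D.L.X ◁ flipPairing ev ≫ (ρ_ D.L.X).hom) ▷ (H ⊗ N) ≫ D.L.X ◁ flipPairing ev ≫
        (ρ_ D.L.X).hom := by
      rw [← whisker_exchange]
      monoidal
    _ = 𝟙 _ ⊗≫ (D.coact ▷ N ≫ (β_ (D.L.X ⊗ H) N).hom) ▷ N ⊗≫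
        (D.L.mul ▷ (H ⊗ N) ≫ D.L.X ◁ flipPairing ev) ≫ (ρ_ D.L.X).hom := by
      rw [D.coact_flipPairing hLN, BraidedCategory.braiding_tensor_left_hom]
      monoidal
    _ = 𝟙 _ ⊗≫ (β_ D.L.X N).hom ▷ N ⊗≫ N ◁ (D.coact ▷ N ≫ (α_ D.L.X H N).hom ≫
        D.L.X ◁ flipPairing ev ≫ (ρ_ D.L.X).hom) ≫ D.L.mul := by
      rw [← whisker_exchange, BraidedCategory.braiding_naturality_left]
      monoidal
    _ = _ := by
      rw [D.coact_flipPairing hLN, BraidedCategory.braiding_tensor_right_hom]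
      monoidal

lemma coact_comul (D : StrictQuasiDual ev) (hev : IsFaithfulQuasiDual ev)
    (hHN : Centralizes H N) (hLN : Centralizes D.L.X N) :
    D.coact ≫ D.L.X ◁ Δ[H] = D.coact ≫ D.coact ▷ H ≫ (α_ D.L.X H H).hom := by
  refine hev.hom_ext_left₂ ?_
  rw [D.coact_comul_flipPairing hev.toIsQuasiDual hHN hLN, D.coact_coact_flipPairing hLN,
    D.L.mul_assoc]

/-- `n (f ↼ h) = S(h₁) ⇀ ((h₂ ⇀ n) f)`. -/
lemma act_braiding_mul (D : StrictQuasiDual ev) (hev : IsFaithfulQuasiDual ev)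
    (hH : Centralizes H H) :
    D.act ▷ N ≫ (β_ D.L.X N).hom ≫ D.L.mul =
      (α_ D.L.X H N).hom ≫ D.L.X ◁ (Δ[H] ▷ N ⊗≫ H ◁ D.harp) ≫ (β_ D.L.X (H ⊗ N)).hom ⊗≫
        H ◁ D.L.mul ≫ D.antipodeHarp :=
  calc
    _ = (β_ D.L.X H).hom ▷ N ≫ (D.antipodeHarp ▷ N ≫ (β_ D.L.X N).hom) ≫ D.L.mul := by
      rw [act, antipodeHarp]
      monoidal
    _ = (α_ D.L.X H N).hom ≫ (β_ D.L.X (H ⊗ N)).hom ≫ ((β_ H N).hom ▷ D.L.X ⊗≫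
        N ◁ D.antipodeHarp ≫ D.L.mul) := by
      rw [BraidedCategory.braiding_naturality_left, BraidedCategory.braiding_tensor_left_hom,
        BraidedCategory.braiding_tensor_right_hom]
      monoidal
    _ = (α_ D.L.X H N).hom ≫ ((β_ D.L.X (H ⊗ N)).hom ≫ (Δ[H] ▷ N ⊗≫ H ◁ D.harp) ▷ D.L.X) ⊗≫
        H ◁ D.L.mul ≫ D.antipodeHarp := by
      rw [D.mul_antipodeHarp hev hH]
      monoidal
    _ = _ := by
      rw [← BraidedCategory.braiding_naturality_right]
      monoidal

/-- `S(h) ⇀ (n f) = (f₀ ↼ h) ⟨n, f₁⟩`. -/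
lemma braiding_mul_antipodeHarp (D : StrictQuasiDual ev) (hLN : Centralizes D.L.X N) :
    (β_ D.L.X (H ⊗ N)).hom ⊗≫ H ◁ D.L.mul ≫ D.antipodeHarp =
      D.coact ▷ (H ⊗ N) ⊗≫ D.L.X ◁ (β_ H H).hom ▷ N ⊗≫ D.act ▷ (H ⊗ N) ≫
        D.L.X ◁ flipPairing ev ≫ (ρ_ D.L.X).hom :=
  calc
    _ = 𝟙 _ ⊗≫ (β_ D.L.X H).hom ▷ N ⊗≫ H ◁ ((β_ D.L.X N).hom ≫ D.L.mul) ≫ D.antipodeHarp := by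
      rw [BraidedCategory.braiding_tensor_right_hom]
      monoidal
    _ = 𝟙 _ ⊗≫ ((β_ D.L.X H).hom ≫ H ◁ D.coact) ▷ N ⊗≫ ((H ⊗ D.L.X) ◁ flipPairing ev ≫
        D.antipodeHarp ▷ 𝟙_ C) ≫ (ρ_ D.L.X).hom := by
      rw [← D.coact_flipPairing hLN]
      monoidal
    _ = 𝟙 _ ⊗≫ (D.coact ▷ H ≫ (β_ (D.L.X ⊗ H) H).hom) ▷ N ⊗≫ D.antipodeHarp ▷ (H ⊗ N) ≫
        D.L.X ◁ flipPairing ev ≫ (ρ_ D.L.X).hom := by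
      rw [whisker_exchange, ← BraidedCategory.braiding_naturality_left]
      monoidal
    _ = _ := by
      rw [BraidedCategory.braiding_tensor_left_hom, act, antipodeHarp]
      monoidal

lemma act_coact (D : StrictQuasiDual ev) (hev : IsFaithfulQuasiDual ev)
    (hH : Centralizes H H) (hLN : Centralizes D.L.X N) :
    D.act ≫ D.coact = (D.coact ⊗ₘ Δ[H]) ≫ tensorμ D.L.X H H H ≫ (D.act ⊗ₘ μ[H]) := by
  refine hev.hom_ext_left ?_
  calc
    _ = D.act ▷ N ≫ (β_ D.L.X N).hom ≫ D.L.mul := by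
      rw [comp_whiskerRight_assoc, D.coact_flipPairing hLN]
    _ = (α_ D.L.X H N).hom ≫ D.L.X ◁ (Δ[H] ▷ N ⊗≫ H ◁ D.harp) ≫ ((β_ D.L.X (H ⊗ N)).hom ⊗≫
        H ◁ D.L.mul ≫ D.antipodeHarp) := by
      rw [D.act_braiding_mul hev hH]
    _ = 𝟙 _ ⊗≫ (D.L.X ◁ (Δ[H] ▷ N ⊗≫ H ◁ D.harp) ≫ D.coact ▷ (H ⊗ N)) ⊗≫
        D.L.X ◁ (β_ H H).hom ▷ N ⊗≫ D.act ▷ (H ⊗ N) ≫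
        D.L.X ◁ flipPairing ev ≫ (ρ_ D.L.X).hom := by
      rw [D.braiding_mul_antipodeHarp hLN]
      monoidal
    _ = 𝟙 _ ⊗≫ D.coact ▷ (H ⊗ N) ⊗≫ (D.L.X ⊗ H) ◁ Δ[H] ▷ N ⊗≫
        D.L.X ◁ ((H ⊗ H) ◁ D.harp ≫ (β_ H H).hom ▷ N) ⊗≫ D.act ▷ (H ⊗ N) ≫
        D.L.X ◁ flipPairing ev ≫ (ρ_ D.L.X).hom := by
      rw [whisker_exchange]
      monoidal
    _ = 𝟙 _ ⊗≫ D.coact ▷ (H ⊗ N) ⊗≫ (D.L.X ⊗ H) ◁ Δ[H] ▷ N ⊗≫ D.L.X ◁ (β_ H H).hom ▷ (H ⊗ N) ⊗≫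
        ((D.L.X ⊗ H) ◁ H ◁ D.harp ≫ D.act ▷ (H ⊗ N)) ≫
        D.L.X ◁ flipPairing ev ≫ (ρ_ D.L.X).hom := by
      rw [whisker_exchange]
      monoidal
    _ = 𝟙 _ ⊗≫ D.coact ▷ (H ⊗ N) ⊗≫ (D.L.X ⊗ H) ◁ Δ[H] ▷ N ⊗≫ D.L.X ◁ (β_ H H).hom ▷ (H ⊗ N) ⊗≫
        D.act ▷ (H ⊗ H ⊗ N) ≫ D.L.X ◁ (H ◁ D.harp ≫ flipPairing ev) ≫ (ρ_ D.L.X).hom := by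
      rw [whisker_exchange]
      monoidal
    _ = _ := by
      rw [D.whiskerLeft_harp_flipPairing hH, tensorμ, MonoidalCategory.tensorHom_def,
        MonoidalCategory.tensorHom_def]
      monoidal

theorem isHopfModule (D : StrictQuasiDual ev) (hev : IsFaithfulQuasiDual ev)
    (hH : (β_ H H).hom = (β_ H H).inv) : IsHopfModule H D.act D.coact := by
  have := D.L.mono_incl
  have := hev.mono_whiskerLeft D.L.incl
  have hHH : Centralizes H H := by
    rw [Centralizes]
    nth_rw 2 [hH]
    exact Iso.hom_inv_id _
  have hHN : Centralizes H N := hev.centralizes hHH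
  have hHL : Centralizes H D.L.X := hHN.of_mono D.L.incl
  have hLN : Centralizes D.L.X N := hev.centralizes hHL.symm
  exact {
    act_one := D.act_one hev hHH
    act_mul := D.act_mul hev hHH
    coact_counit := D.coact_counit hev.toIsQuasiDual hLN
    coact_comul := D.coact_comul hev hHN hLN
    act_coact := D.act_coact hev hHH hLN }

end StrictQuasiDual

end BraidedHopf

theorem theorem1p5 {C : Type u} [Category.{v} C] [MonoidalCategory C] [BraidedCategory C]
    (H : C) [HopfObj H] (hH : (β_ H H).hom = (β_ H H).inv)
    (N : C) [MonObj N] (ev : N ⊗ H ⟶ 𝟙_ C) (hev : BraidedHopf.IsFaithfulQuasiDual ev)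
    (D : BraidedHopf.StrictQuasiDual ev)
    (hC : HasEqualizers C ∨ BraidedHopf.HasCoinvariants D.coact) :
    ∃ (hD : BraidedHopf.IsHopfModule H D.act D.coact)
      (_ : BraidedHopf.HasCoinvariants D.coact),
      Nonempty ((⟨D.L.X, D.act, D.coact, hD⟩ : BraidedHopf.HopfModule H) ≅
        BraidedHopf.HopfModule.free H (BraidedHopf.coinvariants D.coact)) := by
  have hcoinv : BraidedHopf.HasCoinvariants D.coact := hC.elim (fun _ => inferInstance) id
  have hD : BraidedHopf.IsHopfModule H D.act D.coact := D.isHopfModule hev hH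
  exact ⟨hD, hcoinv, hD.nonempty_iso_free⟩
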